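/- A near-far-labeling of a finite simple graph $G$ is a pair $(N,F)$ with $N\subseteq E(G)$ and $F=E(G)\setminus N$. For integers $r\ge t$, an $(r,t)$-threshold-coloring of $G$ with respect to $(N,F)$ is a map $c:V(G)\to\{0,\dots,r-1\}$ such that $|c(u)-c(v)|\le t$ for every $uv\in N$ and $|c(u)-c(v)|>t$ for every $uv\in F$. The graph $G$ is $(r,t)$-total-threshold-colorable if it has an $(r,t)$-threshold-coloring with respect to every near-far-labeling. Theorem. For every integer $n\ge 3$, the prism $C_n\,\square\,K_2$, i.e. the Cartesian product of the cycle $C_n$ of length $n$ and the complete graph $K_2$ on two vertices, is $(31,4)$-total-threshold-colorable. -/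

import Mathlib

/-- A near-far-labeling `(N, F)` of the graph `G`: a set `N` of edges (the near edges) together with
the set `F` of all the remaining edges (the far edges). -/
structure NearFarLabeling {V : Type*} (G : SimpleGraph V) where
  /-- the near edges -/
  N : Set (Sym2 V)
  /-- the far edges -/
  F : Set (Sym2 V)
  near_subset : N ⊆ G.edgeSet
  far_eq : F = G.edgeSet \ N

/-- `c : V → {0, …, r - 1}` is an `(r, t)`-threshold-coloring with respect to the
near-far-labeling `L`. The differences of colors are taken in `ℤ`. -/
def IsThresholdColoring {V : Type*} {G : SimpleGraph V} (L : NearFarLabeling G) (r : ℕ) (t : ℤ)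
    (c : V → Fin r) : Prop :=
  (∀ u v : V, s(u, v) ∈ L.N → |((c u : ℕ) : ℤ) - ((c v : ℕ) : ℤ)| ≤ t) ∧
  (∀ u v : V, s(u, v) ∈ L.F → t < |((c u : ℕ) : ℤ) - ((c v : ℕ) : ℤ)|)

/-- `G` is `(r, t)`-total-threshold-colorable: for every near-far-labeling of `G` there is an
`(r, t)`-threshold-coloring with respect to it. -/
def IsTotalThresholdColorable {V : Type*} (G : SimpleGraph V) (r : ℕ) (t : ℤ) : Prop :=
  ∀ L : NearFarLabeling G, ∃ c : V → Fin r, IsThresholdColoring L r t c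

/-- The prism over the cycle of length `n`: the Cartesian product of the cycle `C_n` and `K_2`. -/
def prism (n : ℕ) : SimpleGraph (Fin n × Fin 2) :=
  (SimpleGraph.cycleGraph n).boxProd (⊤ : SimpleGraph (Fin 2))

/-! The prism is colored rung by rung around the cycle, with the pair on the first rung fixed by
that rung's label alone. Instead of one pair per rung, a whole set of attainable pairs is tracked.
The finite family `pairSets` is an invariant: whatever the labels, it is entered at the third rung
(`exists_pairSet_of_start`), preserved by each further rung (`exists_pairSet_succ`), and each member
contains a pair that closes up to the first rung (`exists_fitsStep_startPair`). These three facts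
are finite checks. -/

/-- The colors `x` and `y` are at distance more than `4` if `far`, and at distance at most `4`
otherwise. -/
def FitsLabel (far : Bool) (x y : ℕ) : Prop :=
  far = (Nat.blt (x + 4) y || Nat.blt (y + 4) x)

instance (far : Bool) (x y : ℕ) : Decidable (FitsLabel far x y) :=
  inferInstanceAs (Decidable (_ = _))

theorem FitsLabel.symm {far : Bool} {x y : ℕ} (h : FitsLabel far x y) : FitsLabel far y x := by
  unfold FitsLabel at *
  rw [h, Bool.or_comm]

theorem FitsLabel.lt_abs {x y : ℕ} (h : FitsLabel true x y) : 4 < |(x : ℤ) - y| := by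
  simp only [FitsLabel, eq_comm (a := true), Bool.or_eq_true, Nat.blt_eq] at h
  rw [_root_.lt_abs]
  omega

theorem FitsLabel.abs_le {x y : ℕ} (h : FitsLabel false x y) : |(x : ℤ) - y| ≤ 4 := by
  have h' := Bool.or_eq_false_iff.1 (Eq.symm h)
  simp only [← Bool.not_eq_true, Nat.blt_eq] at h'
  rw [_root_.abs_le]
  omega

/-- The colors `p` of one rung of a prism and the colors `q` of the next one fit the labels `e`, `f`
of the two edges between these rungs. -/
def FitsStep (e f : Bool) (p q : ℕ × ℕ) : Prop :=
  FitsLabel e p.1 q.1 ∧ FitsLabel f p.2 q.2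

instance (e f : Bool) (p q : ℕ × ℕ) : Decidable (FitsStep e f p q) :=
  inferInstanceAs (Decidable (_ ∧ _))

/-- The colors `q` are admissible for a rung with label `r`. -/
def FitsRung (r : Bool) (q : ℕ × ℕ) : Prop :=
  (q.1 < 31 ∧ q.2 < 31) ∧ FitsLabel r q.1 q.2

instance (r : Bool) (q : ℕ × ℕ) : Decidable (FitsRung r q) :=
  inferInstanceAs (Decidable (_ ∧ _))

/-- The colors of the first rung, depending only on its label. -/
def startPair : Bool → ℕ × ℕ
  | false => (11, 15)
  | true => (11, 18)

/-- A family of sets of color pairs, such that at each rung from the third on all pairs of some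
member of the family can be attained. -/
def pairSets : List (List (ℕ × ℕ)) :=
  [[(3, 10), (10, 15), (14, 6), (23, 18)],
   [(3, 10), (10, 19), (14, 3), (23, 15)],
   [(3, 18), (3, 26), (10, 3), (11, 18), (18, 23), (19, 3)],
   [(6, 6), (11, 7), (11, 15), (19, 19)],
   [(6, 7), (7, 6), (10, 14), (11, 14), (19, 15), (23, 23)],
   [(6, 10), (7, 10), (7, 11), (15, 11), (15, 14), (18, 14)],
   [(6, 10), (11, 10), (11, 14), (14, 11), (18, 15), (18, 19)],
   [(6, 11), (6, 14), (7, 14), (15, 10), (18, 10), (18, 11)],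
   [(6, 14), (6, 23), (7, 14), (10, 15), (10, 23), (14, 19)],
   [(7, 6), (7, 11), (10, 14), (19, 23), (23, 19), (26, 23)],
   [(7, 14), (10, 3), (19, 26), (26, 19)],
   [(10, 6), (10, 11), (15, 18), (18, 14), (23, 26)],
   [(14, 10), (14, 11), (15, 19), (18, 14), (19, 23)],
   [(14, 19), (14, 23), (18, 10), (18, 23), (19, 10), (19, 14)]]

/-- The color pairs used at the second rung. -/
def secondPairs : List (ℕ × ℕ) :=
  [(3, 10), (6, 3), (6, 10), (6, 14), (6, 19), (6, 26), (7, 3), (7, 10), (7, 14), (7, 19), (7, 26),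
   (10, 6), (10, 14), (10, 15), (14, 10), (14, 19), (15, 6), (15, 10), (15, 14), (15, 19), (15, 23),
   (18, 10), (18, 14), (18, 19), (19, 14), (19, 15), (19, 23), (23, 19), (26, 3), (26, 14),
   (26, 23)]

theorem fitsRung_startPair : ∀ r, FitsRung r (startPair r) := by
  decide

/-- Restricting `p` to `secondPairs` only keeps the search finite and small. -/
theorem exists_pairSet_of_start : ∀ r₀ e f r e' f' r', ∃ B ∈ pairSets, ∀ q ∈ B,
    FitsRung r' q ∧ ∃ p ∈ secondPairs,
      FitsStep e f (startPair r₀) p ∧ FitsRung r p ∧ FitsStep e' f' p q := by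
  decide +kernel

/-- Each `q` has its own predecessor `p`, so the choice within a set can wait until the later
labels, including the closing ones, are known. -/
theorem exists_pairSet_succ : ∀ A ∈ pairSets, ∀ e f r, ∃ B ∈ pairSets, ∀ q ∈ B,
    FitsRung r q ∧ ∃ p ∈ A, FitsStep e f p q := by
  decide +kernel

theorem exists_fitsStep_startPair : ∀ A ∈ pairSets, ∀ r₀ e f, ∃ p ∈ A,
    FitsStep e f p (startPair r₀) := by
  decide +kernel

/-- The color pair `q` can be attained at rung `k` by a coloring of the rungs `0, …, k` that starts
with `startPair`. -/
def Attains (r e f : ℕ → Bool) (k : ℕ) (q : ℕ × ℕ) : Prop :=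
  ∃ s : ℕ → ℕ × ℕ, s 0 = startPair (r 0) ∧ s k = q ∧ (∀ i ≤ k, FitsRung (r i) (s i)) ∧
    ∀ i < k, FitsStep (e i) (f i) (s i) (s (i + 1))

theorem attains_zero (r e f : ℕ → Bool) : Attains r e f 0 (startPair (r 0)) := by
  refine ⟨fun _ => startPair (r 0), rfl, rfl, fun i hi => ?_, fun i hi => absurd hi i.not_lt_zero⟩
  obtain rfl := Nat.le_zero.1 hi
  exact fitsRung_startPair _

theorem Attains.succ {r e f : ℕ → Bool} {k : ℕ} {p q : ℕ × ℕ} (hp : Attains r e f k p)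
    (hq : FitsRung (r (k + 1)) q) (hpq : FitsStep (e k) (f k) p q) :
    Attains r e f (k + 1) q := by
  obtain ⟨s, h0, hk, hr, hs⟩ := hp
  refine ⟨Function.update s (k + 1) q, ?_, by simp, fun i hi => ?_, fun i hi => ?_⟩
  · rwa [Function.update_of_ne (by omega)]
  · rcases hi.lt_or_eq with hi | rfl
    · rw [Function.update_of_ne (by omega)]
      exact hr i (by omega)
    · rwa [Function.update_self]
  · rw [Function.update_of_ne (by omega : i ≠ k + 1)]
    rcases (Nat.lt_succ_iff.1 hi).lt_or_eq with hi | rfl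
    · rw [Function.update_of_ne (by omega)]
      exact hs i hi
    · rwa [Function.update_self, hk]

theorem exists_pairSet_attains (r e f : ℕ → Bool) (k : ℕ) :
    ∃ A ∈ pairSets, ∀ q ∈ A, Attains r e f (k + 2) q := by
  induction k with
  | zero =>
    obtain ⟨B, hB, h⟩ := exists_pairSet_of_start (r 0) (e 0) (f 0) (r 1) (e 1) (f 1) (r 2)
    refine ⟨B, hB, fun q hq => ?_⟩
    obtain ⟨hr, p, -, h₀, h₁, h₂⟩ := h q hq
    exact ((attains_zero r e f).succ h₁ h₀).succ hr h₂
  | succ k ih =>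
    obtain ⟨A, hA, h⟩ := ih
    obtain ⟨B, hB, h'⟩ := exists_pairSet_succ A hA (e (k + 2)) (f (k + 2)) (r (k + 3))
    refine ⟨B, hB, fun q hq => ?_⟩
    obtain ⟨hr, p, hp, hpq⟩ := h' q hq
    exact (h p hp).succ hr hpq

/-- Every cyclic sequence of at least three rung labels `r` and edge labels `e`, `f` admits a
closed sequence of color pairs that fits it. -/
theorem exists_cyclic_pairs (r e f : ℕ → Bool) (m : ℕ) :
    ∃ s : ℕ → ℕ × ℕ, ∀ i < m + 3, FitsRung (r i) (s i) ∧
      FitsStep (e i) (f i) (s i) (s ((i + 1) % (m + 3))) := by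
  obtain ⟨A, hA, h⟩ := exists_pairSet_attains r e f m
  obtain ⟨p, hp, hclose⟩ := exists_fitsStep_startPair A hA (r 0) (e (m + 2)) (f (m + 2))
  obtain ⟨s, h0, hk, hr, hs⟩ := h p hp
  refine ⟨s, fun i hi => ⟨hr i (by omega), ?_⟩⟩
  rcases (Nat.lt_succ_iff.1 hi).lt_or_eq with hi | rfl
  · rw [Nat.mod_eq_of_lt (by omega)]
    exact hs i hi
  -- The closing step, from rung `m + 2` back to rung `0`.
  · rwa [Nat.mod_self, h0, hk]

open Classical in
/-- A coloring that fits the label of each edge is a threshold-coloring. -/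
theorem isThresholdColoring_of_fitsLabel {V : Type*} {G : SimpleGraph V} (L : NearFarLabeling G)
    {r : ℕ} {c : V → Fin r}
    (h : ∀ u v, G.Adj u v → FitsLabel (decide (s(u, v) ∈ L.F)) (c u) (c v)) :
    IsThresholdColoring L r 4 c := by
  refine ⟨fun u v huv => ?_, fun u v huv => ?_⟩
  · have hF : s(u, v) ∉ L.F := fun h => (L.far_eq ▸ h).2 huv
    have := h u v (L.near_subset huv)
    rw [decide_eq_false hF] at this
    exact this.abs_le
  · have := h u v (L.far_eq ▸ huv).1
    rw [decide_eq_true huv] at this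
    exact this.lt_abs

/-- A symmetric relation that holds on all rungs `(i, 0), (i, 1)` and on all edges from `(i, j)` to
`(i + 1, j)` holds on all edges of the prism. -/
theorem prism_adj_induction {m : ℕ} {P : Fin (m + 3) × Fin 2 → Fin (m + 3) × Fin 2 → Prop}
    (symm : ∀ u v, P u v → P v u) (rung : ∀ i, P (i, 0) (i, 1))
    (edge : ∀ i j, P (i, j) (i + 1, j)) {u v : Fin (m + 3) × Fin 2}
    (h : (prism (m + 3)).Adj u v) : P u v := by
  obtain ⟨i, j⟩ := u
  obtain ⟨i', j'⟩ := v
  rcases SimpleGraph.boxProd_adj.1 h with ⟨hi, hj⟩ | ⟨hj, hi⟩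
  · obtain rfl : j = j' := hj
    rcases SimpleGraph.cycleGraph_adj.1 hi with hi | hi
    · obtain rfl : i = i' + 1 := by rw [← hi]; simp
      exact symm _ _ (edge i' j)
    · obtain rfl : i' = i + 1 := by rw [← hi]; simp
      exact edge i j
  · obtain rfl : i = i' := hi
    fin_cases j <;> fin_cases j'
    · exact absurd rfl hj.ne
    · exact rung i
    · exact symm _ _ (rung i)
    · exact absurd rfl hj.ne

theorem theorem1 (n : ℕ) (hn : 3 ≤ n) : IsTotalThresholdColorable (prism n) 31 4 := by
  classical
  obtain ⟨m, rfl⟩ := Nat.exists_eq_add_of_le' hn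
  intro L
  let far (u v : Fin (m + 3) × Fin 2) : Bool := decide (s(u, v) ∈ L.F)
  -- Addition in `Fin (m + 3)` wraps around, so index `m + 2` gives the labels of the closing edges.
  obtain ⟨s, hs⟩ := exists_cyclic_pairs
    (fun i => far (Fin.ofNat (m + 3) i, 0) (Fin.ofNat (m + 3) i, 1))
    (fun i => far (Fin.ofNat (m + 3) i, 0) (Fin.ofNat (m + 3) i + 1, 0))
    (fun i => far (Fin.ofNat (m + 3) i, 1) (Fin.ofNat (m + 3) i + 1, 1)) m
  have hs' (i : Fin (m + 3)) : FitsRung (far (i, 0) (i, 1)) (s i) ∧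
      FitsStep (far (i, 0) (i + 1, 0)) (far (i, 1) (i + 1, 1)) (s i) (s (i + 1 : Fin (m + 3))) := by
    have := hs i i.isLt
    simpa [Fin.val_add] using this
  let c (v : Fin (m + 3) × Fin 2) : Fin 31 :=
    if v.2 = 0 then ⟨(s v.1).1, (hs' v.1).1.1.1⟩ else ⟨(s v.1).2, (hs' v.1).1.1.2⟩
  refine ⟨c, isThresholdColoring_of_fitsLabel L fun u v =>
    prism_adj_induction (P := fun u v => FitsLabel (far u v) (c u) (c v)) ?_ ?_ ?_⟩
  · intro u v h
    simpa only [far, Sym2.eq_swap] using h.symm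
  · intro i
    simpa [c] using (hs' i).1.2
  · intro i j
    fin_cases j
    · simpa [c] using (hs' i).2.1
    · simpa [c] using (hs' i).2.2
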